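/- For differential polynomials $P$ with real coefficients in $u_0=u,u_1,u_2,\dots$ (where $u_j=\partial_s^j u$) let $D P=\sum_{j\ge 0}u_{j+1}\,\partial P/\partial u_j$ be the total $s$-derivative, let $\mathtt E P=\sum_{j\ge 0}(-D)^j(\partial P/\partial u_j)$ be the Euler operator, and let $D^{-1}P$ denote the differential polynomial $Q$ without constant term such that $DQ=P$, if there is one. There are sequences of differential polynomials $(\rho_j)_{j\ge1}$ and $(N_j)_{j\ge 1}$ with $\rho_1=\tfrac12u^2$ and, for all $j\ge1$, \[ N_j=D^{-1}\bigl(u\,D\mathtt E\rho_j\bigr),\qquad D\mathtt E\rho_{j+1}=\bigl(D^3+D\,u\,D^{-1}u\,D\bigr)\mathtt E\rho_j=D^3\mathtt E\rho_j+D(uN_j). \] Fix any such sequences and put $M_j=D\mathtt E\rho_j$ and $L_j=2\,\mathtt E\rho_j$, so that $D N_j=uM_j$; the $j$th equation of the mKdV hierarchy is $u_t=M_j$ (thus $M_1=u_1$ and $M_2=u_3+\tfrac32u^2u_1$). Let $\langle\cdot,\cdot\rangle$ be the standard Hermitian inner product on $\mathbb C^2$, linear in its first argument, and let $S^3\subset\mathbb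 C^2$ be the unit sphere. A smooth curve $\gamma:\mathbb R\to S^3$ is a unit-speed Legendrian curve if $\langle\gamma_s,\gamma\rangle=0$ and $\langle\gamma_s,\gamma_s\rangle=1$; its curvature is $k=\operatorname{Im}\langle\gamma_{ss},\gamma_s\rangle$. Along such a curve define $\mathbf V_0=\gamma_s$ and, for $j\ge1$, $\mathbf V_j=N_j\,\gamma_s+M_j\,(\mathrm i\gamma_s)+L_j\,(\mathrm i\gamma)$, with $u$ replaced by $k$ in $N_j,M_j,L_j$, and \[ \mathbf Z_n=\sum_{j=0}^n(-4)^{n-j}\,\mathbf V_j,\qquad n\ge0 . \] Then $\mathbf Z_n$ induces the $(n+1)$st mKdV equation for curvature: let $n\ge0$, let $T\subseteq\mathbb R$ be open, and let $\gamma(s,t)$, $s\in\mathbb R$, $t\in T$, be a smooth family of curves such that $\gamma(\cdot,t)$ is a unit-speed Legendrian curve in $S^3$ for every $t\in T$ and $\partial\gamma/\partial t=\mathbf Z_n$ on $\mathbb R\times T$. Then the curvature $k(s,t)$ of $\gamma(\cdot,t)$ satisfies \[ k_t=M_{n+1}\big|_{u=k}\qquad\text{on }\mathbb R\times T . \] 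-/

import Mathlib

open scoped ContDiff

noncomputable section

namespace LegendrianMKdV

/-- Differential polynomials with real coefficients in one function `u`; the variable `X j`
stands for `u_j`, the `j`-th derivative of `u` with respect to `s`. -/
abbrev DiffPoly : Type := MvPolynomial ℕ ℝ

/-- The total `s`-derivative: the derivation with `u_j ↦ u_{j+1}`, that is
`P ↦ ∑ j, u_{j+1} * ∂P/∂u_j`. -/
def totalD : Derivation ℝ DiffPoly DiffPoly :=
  MvPolynomial.mkDerivation ℝ (fun j : ℕ => (MvPolynomial.X (j + 1) : DiffPoly))

/-- The Euler operator `P ↦ ∑ j, (-D)^j (∂P/∂u_j)`; only the `u_j` occurring in `P` contribute. -/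
def euler (P : DiffPoly) : DiffPoly :=
  ∑ j ∈ P.vars, (-1) ^ j * (totalD^[j]) (MvPolynomial.pderiv j P)

/-- `M_j = D (E ρ_j)`, the right-hand side of the `j`-th equation `u_t = M_j`. -/
def flowM (ρ : ℕ → DiffPoly) (j : ℕ) : DiffPoly := totalD (euler (ρ j))

/-- `L_j = 2 E ρ_j`. -/
def flowL (ρ : ℕ → DiffPoly) (j : ℕ) : DiffPoly := 2 * euler (ρ j)

/-- `ρ_1, ρ_2, …` are densities of the mKdV hierarchy and `N_j = D⁻¹ (u M_j)`, where `D⁻¹` yields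
the antiderivative without constant term: `ρ_1 = u² / 2` and
`D E ρ_{j+1} = (D³ + D u D⁻¹ u D) E ρ_j` for `j ≥ 1`. The entries with index `0` play no role. -/
structure IsMKdVHierarchy (ρ N : ℕ → DiffPoly) : Prop where
  rho_one : ρ 1 = MvPolynomial.C (1 / 2) * MvPolynomial.X 0 ^ 2
  totalD_N : ∀ j, 1 ≤ j → totalD (N j) = MvPolynomial.X 0 * totalD (euler (ρ j))
  constantCoeff_N : ∀ j, 1 ≤ j → MvPolynomial.constantCoeff (N j) = 0
  recursion : ∀ j, 1 ≤ j →
    totalD (euler (ρ (j + 1))) =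
      totalD (totalD (totalD (euler (ρ j)))) + totalD (MvPolynomial.X 0 * N j)

/-- The value at `s` of the differential polynomial `P` with `u` replaced by the function `k`. -/
def evalAt (P : DiffPoly) (k : ℝ → ℝ) (s : ℝ) : ℝ :=
  MvPolynomial.eval (fun j : ℕ => iteratedDeriv j k s) P

/-- `ℂ²` with its standard Hermitian inner product. Mathlib's `inner ℂ v w` is linear in `w`. -/
abbrev C2 : Type := EuclideanSpace ℂ (Fin 2)

/-- `c` is a unit-speed Legendrian curve in `S³ ⊆ ℂ²` (smoothness is required separately). -/
structure IsUnitSpeedLegendrian (c : ℝ → C2) : Prop where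
  mem_sphere : ∀ s, ‖c s‖ = 1
  legendrian : ∀ s, inner ℂ (c s) (deriv c s) = 0
  unit_speed : ∀ s, ‖deriv c s‖ = 1

/-- The curvature `k = Im ⟨c_ss, c_s⟩` of a unit-speed Legendrian curve, where `⟨·,·⟩` is linear
in its first argument; equivalently `c_ss = -c + i k c_s`. -/
def curvature (c : ℝ → C2) (s : ℝ) : ℝ :=
  (inner ℂ (deriv c s) (deriv (deriv c) s)).im

/-- The vector fields `V_0 = c_s` and `V_j = N_j c_s + M_j (i c_s) + L_j (i c)` for `j ≥ 1` along a
unit-speed curve `c`, with `u` replaced by the curvature of `c`. -/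
def fieldV (ρ N : ℕ → DiffPoly) (j : ℕ) (c : ℝ → C2) (s : ℝ) : C2 :=
  if j = 0 then deriv c s
  else
    (evalAt (N j) (curvature c) s : ℂ) • deriv c s
      + (evalAt (flowM ρ j) (curvature c) s : ℂ) • (Complex.I • deriv c s)
      + (evalAt (flowL ρ j) (curvature c) s : ℂ) • (Complex.I • c s)

/-- `Z_n = ∑_{j=0}^n (-4)^(n-j) V_j`. -/
def fieldZ (ρ N : ℕ → DiffPoly) (n : ℕ) (c : ℝ → C2) (s : ℝ) : C2 :=
  ∑ j ∈ Finset.range (n + 1), ((-4 : ℂ) ^ (n - j)) • fieldV ρ N j c s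

end LegendrianMKdV

end

open scoped ContDiff

noncomputable section

namespace LegendrianMKdV

open MvPolynomial

/-! The evolution statement is a frame computation. By the Frenet equation `c_ss = -c + i k c_s`, a
field `A c_s + M (i c_s) + L (i c)` with `D A = u M` and `D L = 2 M` changes the curvature at rate
`D² M + D(u A) + 4 M`. On `V_j` with `j ≥ 1` this is `M_{j+1} + 4 M_j`, and on `V_0` it is `M_1`;
the weights `(-4)^(n-j)` make the sum telescope to `M_{n+1}` (`exists_fieldZ_eq_frameField`,
`deriv_frameField`, `inner_frameField_im`).

Existence of the hierarchy needs `u M_j` to be a total derivative and the recursion to produce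
variational derivatives. The generating functions `N = ∑ N_k z^k` and `G = ∑ G_k z^k` are defined by
`G/z = D² G + u N` and `N² - G²/z + (D G)² = 1`, which can be solved algebraically, without `D⁻¹`.
Differentiating the second relation gives `D N = u D G` (`totalD_seriesN`). Moreover `E N_k = (2k-1)
G_k` (`euler_coeff_seriesN`), so `ρ_k = N_k / (2k-1)` has `E ρ_k = G_k`. -/

/-! ### Total derivative and Euler operator. -/

@[simp]
theorem totalD_X (j : ℕ) : totalD (X j : DiffPoly) = X (j + 1) := mkDerivation_X _ _ _

theorem euler_eq_sum_of_vars_subset {P : DiffPoly} {S : Finset ℕ} (h : P.vars ⊆ S) :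
    euler P = ∑ j ∈ S, (-1) ^ j * (totalD^[j]) (pderiv j P) := by
  refine Finset.sum_subset h fun j _ hj => ?_
  rw [pderiv_eq_zero_of_notMem_vars hj, iterate_map_zero, mul_zero]

theorem totalD_iterate_C_mul (a : ℝ) (j : ℕ) (P : DiffPoly) :
    (totalD^[j]) (C a * P) = C a * (totalD^[j]) P := by
  induction j generalizing P with
  | zero => rfl
  | succ j ih =>
    rw [Function.iterate_succ_apply, Function.iterate_succ_apply, ← ih, ← smul_eq_C_mul,
      ← smul_eq_C_mul, Derivation.map_smul]

theorem euler_C_mul {a : ℝ} (ha : a ≠ 0) (P : DiffPoly) : euler (C a * P) = C a * euler P := by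
  rw [euler, euler, vars_C_mul a ha, Finset.mul_sum]
  refine Finset.sum_congr rfl fun j _ => ?_
  rw [pderiv_C_mul, totalD_iterate_C_mul]
  ring

theorem euler_X_zero_sq : euler (C (1 / 2) * X 0 ^ 2) = X 0 := by
  have hv : (X 0 ^ 2 : DiffPoly).vars ⊆ {0} := (vars_pow _ _).trans (by rw [vars_X])
  rw [euler_C_mul (by norm_num), euler_eq_sum_of_vars_subset hv]
  have h2 : (C (1 / 2) * 2 : DiffPoly) = 1 := by
    rw [← map_ofNat C 2, ← C_mul]; norm_num
  simp only [Finset.sum_singleton, pow_zero, one_mul, Function.iterate_zero, id, pderiv_pow,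
    pderiv_X_self]
  linear_combination (X 0 : DiffPoly) * h2

/-! ### Variations modulo total derivatives. -/

/-- The evolutionary derivation with characteristic `v`: it commutes with `totalD` and maps
`u` to `v`. -/
def evolutionary (v : DiffPoly) : Derivation ℝ DiffPoly DiffPoly :=
  mkDerivation ℝ fun j => (totalD^[j]) v

@[simp]
theorem evolutionary_X (v : DiffPoly) (j : ℕ) : evolutionary v (X j) = (totalD^[j]) v :=
  mkDerivation_X _ _ _

theorem evolutionary_totalD (v P : DiffPoly) :
    evolutionary v (totalD P) = totalD (evolutionary v P) := by
  have h : ⁅evolutionary v, totalD⁆ = 0 := by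
    refine derivation_ext fun j => ?_
    rw [Derivation.commutator_apply, totalD_X, evolutionary_X, evolutionary_X,
      Function.iterate_succ_apply', sub_self, Derivation.zero_apply]
  exact sub_eq_zero.1 ((Derivation.commutator_apply (a := P)).symm.trans (by rw [h]; rfl))

theorem derivation_sum_apply (S : Finset ℕ) (d : ℕ → Derivation ℝ DiffPoly DiffPoly)
    (P : DiffPoly) : (∑ j ∈ S, d j) P = ∑ j ∈ S, d j P := by
  induction S using Finset.cons_induction with
  | empty => simp
  | cons j S hj ih => rw [Finset.sum_cons, Finset.sum_cons, Derivation.add_apply, ih]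

theorem evolutionary_eq_sum (v P : DiffPoly) :
    evolutionary v P = ∑ j ∈ P.vars, (totalD^[j]) v * pderiv j P := by
  have h : evolutionary v P =
      (∑ j ∈ P.vars, (totalD^[j]) v • (pderiv j : Derivation ℝ DiffPoly DiffPoly)) P := by
    refine derivation_eq_of_forall_mem_vars fun i hi => ?_
    rw [evolutionary_X, derivation_sum_apply, Finset.sum_eq_single i]
    · simp
    · intro j _ hji
      simp [pderiv_X_of_ne hji.symm]
    · exact fun h => (h hi).elim
  rw [h, derivation_sum_apply]
  rfl

/-- Integration by parts, `j` times. -/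
theorem exists_totalD_eq_iterate_mul_sub (j : ℕ) (v f : DiffPoly) :
    ∃ Q, totalD Q = (totalD^[j]) v * f - v * ((-1) ^ j * (totalD^[j]) f) := by
  induction j generalizing f with
  | zero => exact ⟨0, by simp⟩
  | succ j ih =>
    obtain ⟨Q, hQ⟩ := ih (totalD f)
    refine ⟨(totalD^[j]) v * f - Q, ?_⟩
    rw [map_sub, hQ, Derivation.leibniz, Function.iterate_succ_apply', Function.iterate_succ_apply]
    simp only [smul_eq_mul]
    ring

/-- Up to total derivatives, the Euler operator is the variational derivative. -/
theorem exists_totalD_eq_evolutionary_sub (v P : DiffPoly) :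
    ∃ Q, totalD Q = evolutionary v P - v * euler P := by
  choose Q hQ using fun j => exists_totalD_eq_iterate_mul_sub j v (pderiv j P)
  refine ⟨∑ j ∈ P.vars, Q j, ?_⟩
  rw [map_sum, evolutionary_eq_sum, euler, Finset.mul_sum, ← Finset.sum_sub_distrib]
  exact Finset.sum_congr rfl fun j _ => hQ j

/-! ### Squares and total derivatives. -/

theorem notMem_vars_of_pderiv_eq_zero {P : DiffPoly} {i : ℕ} (h : pderiv i P = 0) :
    i ∉ P.vars := by
  intro hi
  obtain ⟨d, hd, hid⟩ := (mem_vars_iff_mem_support i).1 hi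
  have h1 := coeff_pderiv (i := i) P (d - Finsupp.single i 1)
  have h2 : d - Finsupp.single i 1 + Finsupp.single i 1 = d := by
    refine tsub_add_cancel_of_le ?_
    rw [Finsupp.single_le_iff]
    exact Nat.one_le_iff_ne_zero.2 (Finsupp.mem_support_iff.1 hid)
  rw [h, coeff_zero, h2] at h1
  rcases mul_eq_zero.1 h1.symm with h3 | h3
  · exact mem_support_iff.1 hd h3
  · exact absurd h3 (by positivity)

theorem pderiv_succ_totalD (m : ℕ) (P : DiffPoly) :
    pderiv (m + 1) (totalD P) = totalD (pderiv (m + 1) P) + pderiv m P := by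
  have h : ⁅pderiv (R := ℝ) (m + 1), totalD⁆ = pderiv m := by
    refine derivation_ext fun j => ?_
    rw [Derivation.commutator_apply, totalD_X]
    simp only [pderiv_X, Pi.single_apply]
    split_ifs <;> simp_all
  rw [← h, Derivation.commutator_apply]
  abel

/-- A nonzero square is not a total derivative. -/
theorem eq_zero_of_totalD_eq_sq {Q v : DiffPoly} (h : totalD Q = v ^ 2) : v = 0 := by
  obtain ⟨m, hm⟩ : ∃ m, Q.vars ⊆ Finset.range m :=
    ⟨Q.vars.sup id + 1, fun j hj => Finset.mem_range.2
      (Nat.lt_succ_of_le (Finset.le_sup (f := id) hj))⟩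
  induction m with
  | zero =>
    have h0 : totalD Q = 0 := derivation_eq_zero_of_forall_mem_vars fun i hi => by
      simpa using hm hi
    exact pow_eq_zero_iff two_ne_zero |>.1 (h ▸ h0)
  | succ m ih =>
    have hQ : pderiv (m + 1) Q = 0 := pderiv_eq_zero_of_notMem_vars fun hi => by
      simpa using hm hi
    -- As `Q` involves only `u_0, …, u_m`, `D Q` is affine in `u_{m+1}` with slope `∂Q/∂u_m`. A
    -- square has even degree in `u_{m+1}`, so the slope vanishes and the order of `Q` drops.
    have h1 : pderiv m Q = 2 * v * pderiv (m + 1) v := by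
      have := pderiv_succ_totalD m Q
      rw [hQ, map_zero, zero_add, h, pderiv_pow] at this
      rw [← this]; norm_num
    have h2 : pderiv (m + 1) (pderiv m Q) = 0 := by
      have hc : ⁅pderiv (R := ℝ) (m + 1), pderiv (R := ℝ) m⁆ = 0 := by
        refine derivation_ext fun j => ?_
        rw [Derivation.commutator_apply]
        simp only [pderiv_X, Pi.single_apply]
        split_ifs <;> simp
      have := Derivation.commutator_apply (D1 := pderiv (R := ℝ) (m + 1))
        (D2 := pderiv (R := ℝ) m) (a := Q)
      rw [hc, hQ, map_zero, sub_zero] at this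
      exact this.symm
    have h3 : pderiv m Q = 0 := by
      by_contra hne
      have hv : 2 * v ≠ 0 := fun h0 => hne (by rw [h1, h0, zero_mul])
      have hv' : pderiv (m + 1) v ≠ 0 := fun h0 => hne (by rw [h1, h0, mul_zero])
      have hd : degreeOf (m + 1) (pderiv m Q) = 0 := by
        have := notMem_vars_of_pderiv_eq_zero h2
        rw [vars_def, Multiset.mem_toFinset] at this
        rw [degreeOf_def, Multiset.count_eq_zero_of_notMem this]
      rw [h1, degreeOf_mul_eq hv hv'] at hd
      have h4 : m + 1 ∉ (2 * v).vars := by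
        rw [vars_def, Multiset.mem_toFinset, ← Multiset.count_eq_zero, ← degreeOf_def]
        omega
      have h5 := pderiv_eq_zero_of_notMem_vars h4
      rw [← map_ofNat C 2, pderiv_C_mul, mul_eq_zero] at h5
      rcases h5 with h5 | h5
      · simp at h5
      · exact hv' h5
    refine ih fun j hj => ?_
    have hj1 := Finset.mem_range.1 (hm hj)
    have hj2 : j ≠ m := fun hjm => notMem_vars_of_pderiv_eq_zero h3 (hjm ▸ hj)
    exact Finset.mem_range.2 (by omega)

/-! ### Derivations of power series. -/

/-- The coefficientwise action of a derivation on power series. -/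
def coeffwise {R : Type*} [CommRing R] [Algebra ℝ R] (d : Derivation ℝ R R) :
    Derivation ℝ (PowerSeries R) (PowerSeries R) :=
  Derivation.mk'
    { toFun := fun f => PowerSeries.mk fun n => d (PowerSeries.coeff n f)
      map_add' := fun f g => by ext n; simp
      map_smul' := fun a f => by ext n; simp }
    (fun f g => by
      ext n
      simp only [LinearMap.coe_mk, AddHom.coe_mk, PowerSeries.coeff_mk, PowerSeries.coeff_mul,
        smul_eq_mul, map_add, map_sum, Derivation.leibniz, Finset.sum_add_distrib]
      congr 1
      rw [← Finset.Nat.sum_antidiagonal_swap]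
      rfl)

@[simp]
theorem coeff_coeffwise {R : Type*} [CommRing R] [Algebra ℝ R] (d : Derivation ℝ R R)
    (f : PowerSeries R) (n : ℕ) :
    PowerSeries.coeff n (coeffwise d f) = d (PowerSeries.coeff n f) :=
  PowerSeries.coeff_mk n fun n => d (PowerSeries.coeff n f)

theorem coeffwise_C {R : Type*} [CommRing R] [Algebra ℝ R] (d : Derivation ℝ R R) (a : R) :
    coeffwise d (PowerSeries.C a) = PowerSeries.C (d a) := by
  ext n
  rw [coeff_coeffwise, PowerSeries.coeff_C, PowerSeries.coeff_C]
  split_ifs <;> simp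

theorem coeffwise_X {R : Type*} [CommRing R] [Algebra ℝ R] (d : Derivation ℝ R R) :
    coeffwise d PowerSeries.X = 0 := by
  ext n
  rw [coeff_coeffwise, PowerSeries.coeff_X]
  split_ifs <;> simp

theorem coeffwise_comm {R : Type*} [CommRing R] [Algebra ℝ R] {d d' : Derivation ℝ R R}
    (h : ∀ a, d (d' a) = d' (d a)) (f : PowerSeries R) :
    coeffwise d (coeffwise d' f) = coeffwise d' (coeffwise d f) := by
  ext n
  simp only [coeff_coeffwise, h]

/-- The derivation `z d/dz` on power series in `z`. -/
def theta (R : Type*) [CommRing R] : Derivation R (PowerSeries R) (PowerSeries R) :=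
  (PowerSeries.X : PowerSeries R) • PowerSeries.derivative R

theorem coeff_theta {R : Type*} [CommRing R] (f : PowerSeries R) (n : ℕ) :
    PowerSeries.coeff n (theta R f) = n * PowerSeries.coeff n f := by
  change PowerSeries.coeff n (PowerSeries.X * PowerSeries.derivative R f) = _
  cases n with
  | zero => simp
  | succ n =>
    rw [PowerSeries.coeff_succ_X_mul, PowerSeries.coeff_derivative]
    push_cast
    ring

theorem theta_C {R : Type*} [CommRing R] (a : R) : theta R (PowerSeries.C a) = 0 := by
  change PowerSeries.X * PowerSeries.derivative R (PowerSeries.C a) = 0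
  rw [PowerSeries.derivative_C, mul_zero]

theorem theta_X {R : Type*} [CommRing R] : theta R PowerSeries.X = PowerSeries.X := by
  change PowerSeries.X * PowerSeries.derivative R PowerSeries.X = PowerSeries.X
  rw [PowerSeries.derivative_X, mul_one]

theorem coeffwise_theta {R : Type*} [CommRing R] [Algebra ℝ R] (d : Derivation ℝ R R)
    (f : PowerSeries R) : coeffwise d (theta R f) = theta R (coeffwise d f) := by
  ext n
  simp [coeff_theta, Derivation.leibniz]

/-! ### Generating functions of the hierarchy. -/

/-- The pairs `(N_k, G_{k+1})` of the hierarchy, with `N_0 = 1` and `G_1 = u`. Here `N_k` is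
solved from the first integral `N² - G² / z + (D G)² = 1` of the generating functions, and
`G_{k+1} = D² G_k + u N_k`. -/
def hierarchyPair : ℕ → DiffPoly × DiffPoly
  | 0 => (1, X 0)
  | k + 1 =>
    let n := C (1 / 2) *
      (∑ i : Fin (k + 1), (hierarchyPair i).2 * (hierarchyPair (k - i)).2
        - ∑ i : Fin k, totalD (hierarchyPair i).2 * totalD (hierarchyPair (k - 1 - i)).2
        - ∑ i : Fin k, (hierarchyPair (i + 1)).1 * (hierarchyPair (k - i)).1)
    (n, totalD (totalD (hierarchyPair k).2) + X 0 * n)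
  decreasing_by all_goals omega

/-- The generating function of the `N_k`. -/
def seriesN : PowerSeries DiffPoly := PowerSeries.mk fun k => (hierarchyPair k).1

/-- The generating function of the `G_{k+1}`. -/
def seriesH : PowerSeries DiffPoly := PowerSeries.mk fun k => (hierarchyPair k).2

/-- The generating function of the `G_k`, with `G_0 = 0`. -/
def seriesG : PowerSeries DiffPoly := PowerSeries.X * seriesH

theorem hierarchyPair_succ_snd (k : ℕ) : (hierarchyPair (k + 1)).2 =
    totalD (totalD (hierarchyPair k).2) + X 0 * (hierarchyPair (k + 1)).1 := by
  rw [hierarchyPair]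

theorem two_mul_hierarchyPair_succ_fst (k : ℕ) : 2 * (hierarchyPair (k + 1)).1 =
    ∑ i ∈ Finset.range (k + 1), (hierarchyPair i).2 * (hierarchyPair (k - i)).2
      - ∑ i ∈ Finset.range k, totalD (hierarchyPair i).2 * totalD (hierarchyPair (k - 1 - i)).2
      - ∑ i ∈ Finset.range k, (hierarchyPair (i + 1)).1 * (hierarchyPair (k - i)).1 := by
  have h2 : (2 * C (1 / 2) : DiffPoly) = 1 := by
    rw [← map_ofNat C 2, ← C_mul]; norm_num
  rw [hierarchyPair, ← mul_assoc, h2, one_mul, Finset.sum_range, Finset.sum_range,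
    Finset.sum_range]

theorem seriesH_eq :
    seriesH = coeffwise totalD (coeffwise totalD seriesG) + PowerSeries.C (X 0) * seriesN := by
  ext1 k
  rw [map_add, PowerSeries.coeff_C_mul, coeff_coeffwise, coeff_coeffwise, seriesG, seriesH,
    seriesN, PowerSeries.coeff_mk, PowerSeries.coeff_mk]
  cases k with
  | zero => simp [hierarchyPair]
  | succ k => rw [PowerSeries.coeff_succ_X_mul, PowerSeries.coeff_mk, hierarchyPair_succ_snd]

theorem coeffwise_totalD_seriesG :
    coeffwise totalD seriesG = PowerSeries.X * coeffwise totalD seriesH := by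
  simp [seriesG, Derivation.leibniz, coeffwise_X]

theorem seriesN_first_integral :
    seriesN ^ 2 - seriesG * seriesH + coeffwise totalD seriesG ^ 2 = 1 := by
  have hG : seriesG * seriesH = PowerSeries.X * (seriesH * seriesH) := by rw [seriesG]; ring
  have hB : coeffwise totalD seriesG ^ 2 = PowerSeries.X *
      (PowerSeries.X * (coeffwise totalD seriesH * coeffwise totalD seriesH)) := by
    rw [coeffwise_totalD_seriesG]; ring
  rw [hG, hB, sq]
  ext1 k
  cases k with
  | zero => simp [seriesN, hierarchyPair]
  | succ k =>
    rw [map_add, map_sub, PowerSeries.coeff_succ_X_mul, PowerSeries.coeff_succ_X_mul,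
      PowerSeries.coeff_mul, PowerSeries.coeff_mul, PowerSeries.coeff_one,
      if_neg (Nat.succ_ne_zero k),
      Finset.Nat.sum_antidiagonal_eq_sum_range_succ_mk,
      Finset.Nat.sum_antidiagonal_eq_sum_range_succ_mk, Finset.sum_range_succ,
      Finset.sum_range_succ']
    have h := two_mul_hierarchyPair_succ_fst k
    have hB : PowerSeries.coeff k
        (PowerSeries.X * (coeffwise totalD seriesH * coeffwise totalD seriesH)) =
        ∑ i ∈ Finset.range k,
          totalD (hierarchyPair i).2 * totalD (hierarchyPair (k - 1 - i)).2 := by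
      cases k with
      | zero => simp
      | succ k =>
        rw [PowerSeries.coeff_succ_X_mul, PowerSeries.coeff_mul,
          Finset.Nat.sum_antidiagonal_eq_sum_range_succ_mk]
        simp [seriesH]
    rw [hB]
    have h0 : (hierarchyPair 0).1 = 1 := by rw [hierarchyPair]
    simp only [seriesN, seriesH, PowerSeries.coeff_mk, Nat.add_sub_add_right, Nat.sub_zero,
      Nat.sub_self, h0]
    linear_combination h

theorem two_ne_zero_series : (2 : PowerSeries DiffPoly) ≠ 0 := fun h =>
  two_ne_zero ((algebraMap ℝ (PowerSeries DiffPoly)).injective (by rw [map_ofNat, h, map_zero]))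

/-- Applying `D` to the first integral and substituting `D² G = H - u N` gives `2 N D N = 2 N u D
G`; the factor `2 N` cancels because `N_0 = 1`. -/
theorem totalD_seriesN : coeffwise totalD seriesN =
    PowerSeries.C (X 0) * coeffwise totalD seriesG := by
  have h := congrArg (coeffwise totalD) seriesN_first_integral
  have hH := seriesH_eq
  have hG : seriesG * coeffwise totalD seriesH = coeffwise totalD seriesG * seriesH := by
    rw [coeffwise_totalD_seriesG, seriesG]; ring
  simp only [map_add, map_sub, sq, Derivation.leibniz, smul_eq_mul, Derivation.map_one_eq_zero]
    at h
  have hN : (2 * seriesN : PowerSeries DiffPoly) ≠ 0 := by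
    refine mul_ne_zero two_ne_zero_series fun h0 => ?_
    have := congrArg (PowerSeries.coeff 0) h0
    simp [seriesN, hierarchyPair] at this
  refine mul_left_cancel₀ hN ?_
  linear_combination h + hG + 2 * coeffwise totalD seriesG * hH

/-! ### Variational derivatives of the `N_k`. -/

/-- Modulo total derivatives, the variation of `N` is `(2 z ∂G/∂z - G) δu`. -/
theorem exists_coeffwise_totalD_eq (v : DiffPoly) :
    ∃ Δ : PowerSeries DiffPoly, coeffwise totalD Δ =
      PowerSeries.C v * (2 * theta _ seriesG - seriesG) - coeffwise (evolutionary v) seriesN := by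
  have hcomm := coeffwise_comm (evolutionary_totalD v)
  set D := coeffwise totalD with hD
  set δ := coeffwise (evolutionary v) with hδ
  set θ := theta DiffPoly
  set G := seriesG
  set H := seriesH
  set N := seriesN
  set u : PowerSeries DiffPoly := PowerSeries.C (X 0) with hu
  set w : PowerSeries DiffPoly := PowerSeries.C v
  set z : PowerSeries DiffPoly := PowerSeries.X
  have hGH : G = z * H := rfl
  have hN : D N = u * D G := totalD_seriesN
  have hDD : D (D G) = H - u * N := eq_sub_of_add_eq seriesH_eq.symm
  have hI : N ^ 2 - G * H + D G ^ 2 = 1 := seriesN_first_integral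
  have δu : δ u = w := by rw [hδ, hu, coeffwise_C, evolutionary_X]; rfl
  have θu : θ u = 0 := theta_C _
  have δz : δ z = 0 := coeffwise_X _
  have θz : θ z = z := theta_X
  have δD : ∀ f, D (δ f) = δ (D f) := fun f => (hcomm f).symm
  have θD : ∀ f, D (θ f) = θ (D f) := fun f => coeffwise_theta _ f
  have δG : δ G = z * δ H := by rw [hGH, Derivation.leibniz, δz]; simp
  have θG : θ G = z * θ H + z * H := by
    rw [hGH, Derivation.leibniz, θz]; simp only [smul_eq_mul]; ring
  have δN : D (δ N) = w * D G + u * δ (D G) := by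
    rw [δD, hN, Derivation.leibniz, δu]; simp only [smul_eq_mul]; ring
  have θN : D (θ N) = u * θ (D G) := by
    rw [θD, hN, Derivation.leibniz, θu]; simp only [smul_eq_mul]; ring
  have δB : D (δ (D G)) = δ H - w * N - u * δ N := by
    rw [δD, hDD, map_sub, Derivation.leibniz, δu]; simp only [smul_eq_mul]; ring
  have θB : D (θ (D G)) = θ H - u * θ N := by
    rw [θD, hDD, map_sub, Derivation.leibniz, θu]; simp only [smul_eq_mul]; ring
  have δI : 2 * (N * δ N - H * δ G + D G * δ (D G)) = 0 := by
    have := congrArg δ hI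
    simp only [map_add, map_sub, sq, Derivation.leibniz, smul_eq_mul,
      Derivation.map_one_eq_zero] at this
    linear_combination this + δ H * hGH - H * δG
  have δI' : N * δ N - H * δ G + D G * δ (D G) = 0 :=
    (mul_eq_zero.1 δI).resolve_left two_ne_zero_series
  have θI : 2 * N * θ N - H * (2 * θ G - G) + 2 * D G * θ (D G) = 0 := by
    have := congrArg θ hI
    simp only [map_add, map_sub, sq, Derivation.leibniz, smul_eq_mul,
      Derivation.map_one_eq_zero] at this
    linear_combination this + (H + θ H) * hGH - H * θG
  -- The witness is the determinant with rows `(N, G, D G)`, its `δ`-variation, and `(2θN, 2θG - G,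
  -- 2θ(D G))`, the last being `2θ` taken after rescaling `G` by `z^(-1/2)`. `D` acts on the first
  -- row by a trace-free matrix, so only the inhomogeneous terms `(w D G, 0, -w N)` and `(0, -D G,
  -- -H)` of the other two rows contribute. By `hI`, `θI` and `δI'` they give `w (2θG - G)` and
  -- `-δN`.
  refine ⟨N * (δ G * (2 * θ (D G)) - δ (D G) * (2 * θ G - G))
    - G * (δ N * (2 * θ (D G)) - δ (D G) * (2 * θ N))
    + D G * (δ N * (2 * θ G - G) - δ G * (2 * θ N)), ?_⟩
  have D2 : D (2 : PowerSeries DiffPoly) = 0 := by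
    rw [← map_ofNat PowerSeries.C 2, hD, coeffwise_C, ← map_ofNat C 2, derivation_C, map_zero]
  simp only [map_add, map_sub, Derivation.leibniz, smul_eq_mul, D2, hDD, hN, δN, θN, δB, θB,
    δD G, θD G]
  linear_combination (w * (2 * θ G - G) - δ N) * hI - w * G * θI + N * δI'
    + δ N * (H * (2 * θG - hGH) - (H + 2 * θ H) * hGH)
    + 2 * θ N * (δ H * hGH - H * δG) + N * ((2 * θ H + H) * δG - δ H * (2 * θG - hGH))

/-- For every `v`, `v` times the difference of the two sides is a total derivative. Taking `v` to be
that difference makes `v²` a total derivative, hence `v = 0`. -/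
theorem euler_coeff_seriesN (k : ℕ) : euler (PowerSeries.coeff k seriesN) =
    C (2 * (k : ℝ) - 1) * PowerSeries.coeff k seriesG := by
  refine sub_eq_zero.1 ?_
  set v := euler (PowerSeries.coeff k seriesN) - C (2 * (k : ℝ) - 1) * PowerSeries.coeff k seriesG
    with hv
  obtain ⟨Δ, hΔ⟩ := exists_coeffwise_totalD_eq v
  obtain ⟨Q, hQ⟩ := exists_totalD_eq_evolutionary_sub v (PowerSeries.coeff k seriesN)
  have h := congrArg (PowerSeries.coeff k) hΔ
  rw [coeff_coeffwise, map_sub, coeff_coeffwise, PowerSeries.coeff_C_mul, map_sub,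
    ← map_ofNat PowerSeries.C 2, PowerSeries.coeff_C_mul, coeff_theta] at h
  refine eq_zero_of_totalD_eq_sq (Q := -(PowerSeries.coeff k Δ + Q)) ?_
  rw [map_neg, map_add, h, hQ]
  have hC : (C (2 * (k : ℝ) - 1) : DiffPoly) = 2 * k - 1 := by
    rw [map_sub, map_mul, map_ofNat, map_natCast, map_one]
  rw [hC] at hv
  linear_combination (-v) * hv

/-! ### Constant terms and existence of the hierarchy. -/

theorem constantCoeff_totalD (P : DiffPoly) : constantCoeff (totalD P) = 0 := by
  induction P using MvPolynomial.induction_on with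
  | C a => rw [derivation_C, map_zero]
  | add p q hp hq => rw [map_add, map_add, hp, hq, add_zero]
  | mul_X p j hp => simp [Derivation.leibniz, hp]

theorem constantCoeff_hierarchyPair_snd (k : ℕ) : constantCoeff (hierarchyPair k).2 = 0 := by
  cases k with
  | zero => simp [hierarchyPair]
  | succ k => simp [hierarchyPair_succ_snd, constantCoeff_totalD]

theorem constantCoeff_hierarchyPair_succ_fst (k : ℕ) :
    constantCoeff (hierarchyPair (k + 1)).1 = 0 := by
  induction k using Nat.strong_induction_on with
  | _ k ih =>
    have h := congrArg constantCoeff (two_mul_hierarchyPair_succ_fst k)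
    rw [← map_ofNat C 2] at h
    have h0 : ∑ i ∈ Finset.range k, constantCoeff (hierarchyPair (i + 1)).1 *
        constantCoeff (hierarchyPair (k - i)).1 = 0 :=
      Finset.sum_eq_zero fun i hi => by rw [ih i (Finset.mem_range.1 hi), zero_mul]
    simpa [constantCoeff_hierarchyPair_snd, constantCoeff_totalD, h0] using h

theorem exists_isMKdVHierarchy : ∃ ρ N : ℕ → DiffPoly, IsMKdVHierarchy ρ N := by
  have hne : ∀ j : ℕ, 1 ≤ j → (2 * (j : ℝ) - 1) ≠ 0 := fun j hj => by
    have : (1 : ℝ) ≤ j := by exact_mod_cast hj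
    linarith
  have hE : ∀ j : ℕ, 1 ≤ j →
      euler (C (2 * (j : ℝ) - 1)⁻¹ * PowerSeries.coeff j seriesN) =
        PowerSeries.coeff j seriesG := fun j hj => by
    rw [euler_C_mul (inv_ne_zero (hne j hj)), euler_coeff_seriesN, ← mul_assoc, ← C_mul,
      inv_mul_cancel₀ (hne j hj), C_1, one_mul]
  refine ⟨fun j => C (2 * (j : ℝ) - 1)⁻¹ * PowerSeries.coeff j seriesN,
    fun j => PowerSeries.coeff j seriesN, ?_, ?_, ?_, ?_⟩
  · simp only [seriesN, PowerSeries.coeff_mk]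
    rw [hierarchyPair]
    norm_num [hierarchyPair]
    ring
  · intro j hj
    rw [hE j hj, ← coeff_coeffwise, totalD_seriesN, PowerSeries.coeff_C_mul, coeff_coeffwise]
  · intro j hj
    obtain ⟨k, rfl⟩ := Nat.exists_eq_add_of_le' hj
    rw [seriesN, PowerSeries.coeff_mk, constantCoeff_hierarchyPair_succ_fst]
  · intro j hj
    have h := congrArg (PowerSeries.coeff j) seriesH_eq
    rw [map_add, PowerSeries.coeff_C_mul, coeff_coeffwise, coeff_coeffwise] at h
    rw [hE j hj, hE (j + 1) (by omega), seriesG, PowerSeries.coeff_succ_X_mul, h, map_add]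
    rfl

/-! ### Evaluation along functions, and mixed partial derivatives. -/

theorem hasDerivAt_evalAt {k : ℝ → ℝ} (hk : ContDiff ℝ ∞ k) (P : DiffPoly) (s : ℝ) :
    HasDerivAt (evalAt P k) (evalAt (totalD P) k s) s := by
  unfold evalAt
  induction P using MvPolynomial.induction_on with
  | C a => simpa using hasDerivAt_const s a
  | add p q hp hq =>
    simp only [map_add]
    exact hp.add hq
  | mul_X p j hp =>
    have hj : HasDerivAt (iteratedDeriv j k) (iteratedDeriv (j + 1) k s) s := by
      rw [iteratedDeriv_succ]
      exact (hk.differentiable_iteratedDeriv j (by exact_mod_cast ENat.natCast_lt_top j) s).hasDerivAt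
    have := hp.mul hj
    simp only [map_mul, eval_X, Derivation.leibniz, smul_eq_mul, totalD_X, map_add]
    exact this.congr_deriv (by ring)

/-- Partial derivatives of a smooth function of two variables commute. -/
theorem hasDerivAt_deriv_of_contDiffOn {E : Type*} [NormedAddCommGroup E] [NormedSpace ℝ E]
    {F W : ℝ → ℝ → E} {T : Set ℝ} (hT : IsOpen T)
    (hF : ContDiffOn ℝ ∞ (fun p : ℝ × ℝ => F p.1 p.2) (T ×ˢ Set.univ))
    (hW : ∀ t ∈ T, ∀ s, HasDerivAt (fun τ => F τ s) (W t s) t) :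
    ContDiffOn ℝ ∞ (fun p : ℝ × ℝ => deriv (F p.1) p.2) (T ×ˢ Set.univ) ∧
      ∀ t ∈ T, ∀ s, HasDerivAt (fun τ => deriv (F τ) s) (deriv (W t) s) t := by
  set f : ℝ × ℝ → E := fun p => F p.1 p.2
  have hU : IsOpen (T ×ˢ (Set.univ : Set ℝ)) := hT.prod isOpen_univ
  have hf' : ContDiffOn ℝ ∞ (fderiv ℝ f) (T ×ˢ Set.univ) :=
    hF.fderiv_of_isOpen hU (by simp)
  have hmem : ∀ {t}, t ∈ T → ∀ s : ℝ, T ×ˢ (Set.univ : Set ℝ) ∈ nhds (t, s) := fun ht s =>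
    hU.mem_nhds ⟨ht, trivial⟩
  have hd : ∀ {t}, t ∈ T → ∀ s, HasFDerivAt f (fderiv ℝ f (t, s)) (t, s) := fun ht s =>
    ((hF.contDiffAt (hmem ht s)).differentiableAt (by simp)).hasFDerivAt
  have hd' : ∀ {t}, t ∈ T → ∀ s,
      HasFDerivAt (fderiv ℝ f) (fderiv ℝ (fderiv ℝ f) (t, s)) (t, s) := fun ht s =>
    ((hf'.contDiffAt (hmem ht s)).differentiableAt (by simp)).hasFDerivAt
  have hpath₁ : ∀ t s : ℝ, HasDerivAt (fun τ : ℝ => (τ, s)) ((1 : ℝ), (0 : ℝ)) t := fun t s =>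
    (hasDerivAt_id t).prodMk (hasDerivAt_const t s)
  have hpath₂ : ∀ t s : ℝ, HasDerivAt (fun σ : ℝ => (t, σ)) ((0 : ℝ), (1 : ℝ)) s := fun t s =>
    (hasDerivAt_const s t).prodMk (hasDerivAt_id s)
  have hs : ∀ t ∈ T, ∀ s, deriv (F t) s = fderiv ℝ f (t, s) (0, 1) := fun t ht s =>
    ((hd ht s).comp_hasDerivAt s (hpath₂ t s)).deriv
  have ht' : ∀ t ∈ T, ∀ s, W t s = fderiv ℝ f (t, s) (1, 0) := fun t ht s =>
    (hW t ht s).unique (HasFDerivAt.comp_hasDerivAt (l := f) t (hd ht s) (hpath₁ t s))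
  refine ⟨(hf'.clm_apply contDiffOn_const).congr fun p hp => hs p.1 hp.1 p.2, fun t ht s => ?_⟩
  have h₁ : HasDerivAt (fun τ => fderiv ℝ f (τ, s) (0, 1))
      (fderiv ℝ (fderiv ℝ f) (t, s) (1, 0) (0, 1)) t :=
    (ContinuousLinearMap.apply ℝ E ((0 : ℝ), (1 : ℝ))).hasFDerivAt.comp_hasDerivAt t
      (HasFDerivAt.comp_hasDerivAt (l := fderiv ℝ f) t (hd' ht s) (hpath₁ t s))
  have h₂ : HasDerivAt (fun σ => fderiv ℝ f (t, σ) (1, 0))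
      (fderiv ℝ (fderiv ℝ f) (t, s) (0, 1) (1, 0)) s :=
    (ContinuousLinearMap.apply ℝ E ((1 : ℝ), (0 : ℝ))).hasFDerivAt.comp_hasDerivAt s
      (HasFDerivAt.comp_hasDerivAt (l := fderiv ℝ f) s (hd' ht s) (hpath₂ t s))
  have hsymm : IsSymmSndFDerivAt ℝ f (t, s) :=
    (hF.contDiffAt (hmem ht s)).isSymmSndFDerivAt
      (by rw [minSmoothness_of_isRCLikeNormedField]; exact WithTop.coe_le_coe.2 le_top)
  rw [funext (ht' t ht), h₂.deriv, hsymm]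
  exact h₁.congr_of_eventuallyEq (Filter.eventually_of_mem (hT.mem_nhds ht) fun τ hτ => hs τ hτ s)

/-! ### Legendrian curves and their frames. -/

theorem contDiff_curvature {c : ℝ → C2} (hc : ContDiff ℝ ∞ c) : ContDiff ℝ ∞ (curvature c) := by
  have h₁ := (contDiff_infty_iff_deriv.1 hc).2
  have h₂ := (contDiff_infty_iff_deriv.1 h₁).2
  exact Complex.imCLM.contDiff.comp (h₁.inner ℂ h₂)

theorem IsUnitSpeedLegendrian.inner_deriv {c : ℝ → C2} (h : IsUnitSpeedLegendrian c) (s : ℝ) :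
    inner ℂ (deriv c s) (deriv c s) = 1 := by
  rw [inner_self_eq_norm_sq_to_K, h.unit_speed]; simp

theorem IsUnitSpeedLegendrian.inner_deriv_left {c : ℝ → C2} (h : IsUnitSpeedLegendrian c)
    (s : ℝ) : inner ℂ (deriv c s) (c s) = 0 := by
  rw [← inner_conj_symm, h.legendrian, map_zero]

/-- The Frenet equation of a unit-speed Legendrian curve. -/
theorem IsUnitSpeedLegendrian.deriv_deriv {c : ℝ → C2} (h : IsUnitSpeedLegendrian c)
    (hc : ContDiff ℝ ∞ c) (s : ℝ) :
    deriv (deriv c) s = -c s + ((curvature c s : ℂ) * Complex.I) • deriv c s := by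
  have h₁ : HasDerivAt c (deriv c s) s := (hc.differentiable (by simp) s).hasDerivAt
  have h₂ : HasDerivAt (deriv c) (deriv (deriv c) s) s :=
    ((contDiff_infty_iff_deriv.1 hc).2.differentiable (by simp) s).hasDerivAt
  have e₁ : inner ℂ (c s) (deriv (deriv c) s) = -1 := by
    have := h₁.inner ℂ h₂
    rw [funext h.legendrian, h.inner_deriv] at this
    exact eq_neg_of_add_eq_zero_left (this.unique (hasDerivAt_const s 0))
  have e₂ : inner ℂ (deriv c s) (deriv (deriv c) s) = (curvature c s : ℂ) * Complex.I := by
    have := h₂.inner ℂ h₂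
    rw [funext h.inner_deriv] at this
    have h0 := congrArg Complex.re (this.unique (hasDerivAt_const s 1))
    rw [← inner_conj_symm (deriv (deriv c) s)] at h0
    simp only [Complex.add_re, Complex.conj_re, Complex.zero_re] at h0
    apply Complex.ext
    · simp; linarith
    · simp [curvature]
  -- `c` and `c_s` form a unitary basis of `ℂ²`, so `e₁` and `e₂` determine `c_ss`.
  have ho : Orthonormal ℂ ![c s, deriv c s] := by
    rw [orthonormal_iff_ite]
    intro i j
    fin_cases i <;> fin_cases j <;>
      simp [h.mem_sphere, h.unit_speed, h.legendrian, h.inner_deriv_left]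
  let b := basisOfOrthonormalOfCardEqFinrank ho (by simp)
  refine InnerProductSpace.ext_inner_left_basis b fun i => ?_
  fin_cases i
  · simp [b, inner_add_right, inner_smul_right, e₁, h.mem_sphere, h.legendrian]
  · simp [b, inner_add_right, inner_smul_right, e₂, h.inner_deriv_left, h.unit_speed]

/-- The vector field `(p + i q) c_s + (r + i l) c` along `c`, with `u` replaced by the curvature. -/
def frameField (p q r l : DiffPoly) (c : ℝ → C2) (s : ℝ) : C2 :=
  ((evalAt p (curvature c) s : ℂ) + (evalAt q (curvature c) s : ℂ) * Complex.I) • deriv c s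
    + ((evalAt r (curvature c) s : ℂ) + (evalAt l (curvature c) s : ℂ) * Complex.I) • c s

theorem hasDerivAt_evalAt_add_mul_I {k : ℝ → ℝ} (hk : ContDiff ℝ ∞ k) (P Q : DiffPoly) (s : ℝ) :
    HasDerivAt (fun σ => (evalAt P k σ : ℂ) + (evalAt Q k σ : ℂ) * Complex.I)
      ((evalAt (totalD P) k s : ℂ) + (evalAt (totalD Q) k s : ℂ) * Complex.I) s :=
  (hasDerivAt_evalAt hk P s).ofReal_comp.add
    ((hasDerivAt_evalAt hk Q s).ofReal_comp.mul_const Complex.I)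

theorem deriv_frameField {c : ℝ → C2} (h : IsUnitSpeedLegendrian c) (hc : ContDiff ℝ ∞ c)
    (p q r l : DiffPoly) :
    deriv (frameField p q r l c) =
      frameField (totalD p - X 0 * q + r) (totalD q + X 0 * p + l) (totalD r - p)
        (totalD l - q) c := by
  funext s
  have hk := contDiff_curvature hc
  have h₁ : HasDerivAt c (deriv c s) s := (hc.differentiable (by simp) s).hasDerivAt
  have h₂ : HasDerivAt (deriv c) (deriv (deriv c) s) s :=
    ((contDiff_infty_iff_deriv.1 hc).2.differentiable (by simp) s).hasDerivAt
  have hd := ((hasDerivAt_evalAt_add_mul_I hk p q s).smul h₂).add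
    ((hasDerivAt_evalAt_add_mul_I hk r l s).smul h₁)
  refine hd.deriv.trans ?_
  rw [h.deriv_deriv hc]
  simp only [frameField, evalAt, map_add, map_sub, map_mul, eval_X, iteratedDeriv_zero,
    Complex.ofReal_add, Complex.ofReal_sub, Complex.ofReal_mul]
  match_scalars
  · ring
  · linear_combination ((eval (fun j => iteratedDeriv j (curvature c) s) q : ℂ) *
      curvature c s) * Complex.I_sq

/-- This is the product rule for the `t`-derivative of the curvature: the unprimed field stands for
`∂_t c_s`, the primed one for `∂_t c_ss`. -/
theorem inner_frameField_im {c : ℝ → C2} (h : IsUnitSpeedLegendrian c)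
    (p q r l p' q' r' l' : DiffPoly) (s : ℝ) (hc : ContDiff ℝ ∞ c) :
    (inner ℂ (deriv c s) (frameField p' q' r' l' c s)
      + inner ℂ (frameField p q r l c s) (deriv (deriv c) s)).im =
      evalAt (q' + X 0 * p + l) (curvature c) s := by
  rw [h.deriv_deriv hc]
  simp [frameField, evalAt, inner_add_left, inner_smul_left,
    h.mem_sphere, h.unit_speed, h.legendrian, h.inner_deriv_left]
  ring

/-! ### Curvature evolution under `Z_n`. -/

theorem fieldZ_succ (ρ N : ℕ → DiffPoly) (n : ℕ) (c : ℝ → C2) (s : ℝ) :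
    fieldZ ρ N (n + 1) c s = (-4 : ℂ) • fieldZ ρ N n c s + fieldV ρ N (n + 1) c s := by
  rw [fieldZ, fieldZ, Finset.sum_range_succ, Nat.sub_self, pow_zero, one_smul, Finset.smul_sum]
  congr 1
  refine Finset.sum_congr rfl fun j hj => ?_
  have hj' := Finset.mem_range.1 hj
  rw [smul_smul, ← pow_succ', show n + 1 - j = n - j + 1 by omega]

/-- The telescoping, one step at a time: passing to `n + 1` multiplies the old rate `M_{n+1}` by
`-4`, which cancels the `4 M_{n+1}` contributed by `V_{n+1}`. -/
theorem IsMKdVHierarchy.exists_fieldZ_eq_frameField {ρ N : ℕ → DiffPoly}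
    (h : IsMKdVHierarchy ρ N) (n : ℕ) : ∃ A M L : DiffPoly,
      (∀ c s, fieldZ ρ N n c s = frameField A M 0 L c s) ∧
      totalD A = X 0 * M ∧ totalD L = 2 * M ∧
      totalD (totalD M) + totalD (X 0 * A) + 4 * M = flowM ρ (n + 1) := by
  induction n with
  | zero =>
    refine ⟨1, 0, 0, fun c s => ?_, by simp, by simp, ?_⟩
    · simp [fieldZ, fieldV, frameField, evalAt]
    · rw [flowM, h.rho_one, euler_X_zero_sq]
      simp
  | succ n ih =>
    obtain ⟨A, M, L, hZ, hA, hL, hM⟩ := ih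
    have h4 : ∀ P : DiffPoly, totalD (-4 * P) = -4 * totalD P := fun P => by
      have : (-4 : DiffPoly) = C (-4) := by rw [map_neg, map_ofNat]
      rw [this, ← smul_eq_C_mul, ← smul_eq_C_mul, Derivation.map_smul]
    refine ⟨-4 * A + N (n + 1), -4 * M + flowM ρ (n + 1), -4 * L + flowL ρ (n + 1),
      fun c s => ?_, ?_, ?_, ?_⟩
    · rw [fieldZ_succ, hZ, fieldV, if_neg n.succ_ne_zero]
      simp only [frameField, evalAt, map_add, map_mul, map_neg, map_ofNat, map_zero,
        Complex.ofReal_add, Complex.ofReal_mul, Complex.ofReal_neg, Complex.ofReal_ofNat,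
        Complex.ofReal_zero]
      match_scalars <;> ring
    · rw [map_add, h4, hA, h.totalD_N _ (by omega), flowM]
      ring
    · have h2 : totalD (2 : DiffPoly) = 0 := by rw [← map_ofNat C 2, derivation_C]
      rw [map_add, h4, hL, flowL, flowM, Derivation.leibniz, h2]
      simp only [smul_eq_mul]
      ring
    · have hr := h.recursion (n + 1) (by omega)
      simp only [flowM] at hM ⊢
      rw [hr, mul_add, map_add, map_add, map_add, h4, h4, mul_left_comm, h4]
      linear_combination (-4) * hM

theorem IsMKdVHierarchy.hasDerivAt_curvature {ρ N : ℕ → DiffPoly} (h : IsMKdVHierarchy ρ N)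
    {n : ℕ} {T : Set ℝ} {γ : ℝ → ℝ → C2} (hT : IsOpen T)
    (hγ : ContDiffOn ℝ ∞ (fun p : ℝ × ℝ => γ p.1 p.2) (T ×ˢ Set.univ))
    (hL : ∀ t ∈ T, IsUnitSpeedLegendrian (γ t))
    (hZ : ∀ t ∈ T, ∀ s : ℝ, HasDerivAt (fun τ => γ τ s) (fieldZ ρ N n (γ t) s) t)
    {t : ℝ} (ht : t ∈ T) (s : ℝ) :
    HasDerivAt (fun τ => curvature (γ τ) s)
      (evalAt (flowM ρ (n + 1)) (curvature (γ t)) s) t := by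
  obtain ⟨A, M, L, hZ', hA, hDL, hM⟩ := h.exists_fieldZ_eq_frameField n
  have hc : ContDiff ℝ ∞ (γ t) :=
    contDiffOn_univ.1 (hγ.comp (contDiff_prodMk_right t).contDiffOn fun s _ => ⟨ht, trivial⟩)
  obtain ⟨hγ₁, hZ₁⟩ := hasDerivAt_deriv_of_contDiffOn hT hγ hZ
  obtain ⟨-, hZ₂⟩ := hasDerivAt_deriv_of_contDiffOn hT hγ₁ hZ₁
  have hd := (hZ₁ t ht s).inner ℂ (hZ₂ t ht s)
  rw [funext (hZ' (γ t)), deriv_frameField (hL t ht) hc, deriv_frameField (hL t ht) hc] at hd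
  have hk := Complex.imCLM.hasFDerivAt.comp_hasDerivAt t hd
  refine hk.congr_deriv ((inner_frameField_im (hL t ht) _ _ _ _ _ _ _ _ s hc).trans ?_)
  congr 1
  simp only [map_add, hA, hDL]
  -- The `c_s`-coefficient `D A - u M` of `∂_t c_s` is zero. The `4 M` is `D L = 2 M` plus `D L - M
  -- = M` twice: once in `∂_t c_ss`, once from pairing `∂_t c_s` with `c_ss`.
  linear_combination hM

end LegendrianMKdV

end

theorem mainTheorem3 :
    (∃ ρ N : ℕ → LegendrianMKdV.DiffPoly, LegendrianMKdV.IsMKdVHierarchy ρ N) ∧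
    ∀ ρ N : ℕ → LegendrianMKdV.DiffPoly, LegendrianMKdV.IsMKdVHierarchy ρ N →
      ∀ (n : ℕ) (T : Set ℝ) (γ : ℝ → ℝ → LegendrianMKdV.C2),
        IsOpen T →
        ContDiffOn ℝ ∞ (fun p : ℝ × ℝ => γ p.1 p.2) (T ×ˢ Set.univ) →
        (∀ t ∈ T, LegendrianMKdV.IsUnitSpeedLegendrian (γ t)) →
        (∀ t ∈ T, ∀ s : ℝ,
          HasDerivAt (fun τ => γ τ s) (LegendrianMKdV.fieldZ ρ N n (γ t) s) t) →
        ∀ t ∈ T, ∀ s : ℝ,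
          HasDerivAt (fun τ => LegendrianMKdV.curvature (γ τ) s)
            (LegendrianMKdV.evalAt (LegendrianMKdV.flowM ρ (n + 1))
              (LegendrianMKdV.curvature (γ t)) s) t := by
  exact ⟨LegendrianMKdV.exists_isMKdVHierarchy, fun ρ N h n T γ hT hγ hL hZ t ht s =>
    h.hasDerivAt_curvature hT hγ hL hZ ht s⟩
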